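/- A category $\mathcal C$ is called *proto-abelian* if (1) it has a zero object; (2) every diagram $C \twoheadleftarrow A \hookrightarrow B$ can be completed to a pushout square, and every diagram $C \hookrightarrow D \twoheadleftarrow B$ can be completed to a pullback square, of the form $$\begin{array}{ccc} A & \hookrightarrow & B\\ \downarrow & & \downarrow\\ C & \hookrightarrow & D\end{array}\qquad(*)$$ with horizontal maps monomorphisms and vertical maps epimorphisms; (3) a commutative square of the form $(*)$ is a pushout square if and only if it is a pullback square; such squares are then called *biCartesian*. Let $\mathcal C$ be a proto-abelian category with a fixed zero object $0$. For $n\ge 0$ let $\mathcal S_n$ be the maximal groupoid in the category of commutative triangular diagrams $(A_{i,j})_{0\le i\le j\le n}$ in $\mathcal C$ (with maps $A_{i,j}\to A_{i',j'}$ for $i\le i'$, $j\le j'$) such that $A_{i,i}=0$ for all $i$, all horizontal maps $A_{i,j}\to A_{i,k}$ are monomorphisms, all vertical maps $A_{i,k}\to A_{j,k}$ are epimorphisms, and all squares are biCartesian. Reindexing of diagrams along monotone maps makes $\mathcal S_\bullet$ a simplicial groupoid (the simplicial groupoid of flags in $\mathcal C$): the face map $\partial_k$ deletes the $k$th row and column,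 and the degeneracy map $\sigma_k$ doubles them. A strictly commutative square of groupoids with corners $\mathcal X,\mathcal B,\mathcal A,\mathcal D$ and functors $F'\colon\mathcal X\to\mathcal B$, $G'\colon\mathcal X\to\mathcal A$, $F\colon\mathcal A\to\mathcal D$, $G\colon\mathcal B\to\mathcal D$ is a *2-pullback square* if $x\mapsto (G'(x),F'(x),\mathrm{id})$ is an equivalence from $\mathcal X$ to the groupoid of triples $(a,b,\varphi\colon F(a)\cong G(b))$, whose morphisms are the pairs of morphisms in $\mathcal A$ and $\mathcal B$ compatible with the isomorphisms $\varphi$. For a simplicial groupoid $\mathcal X_\bullet$ and a nonempty $I\subseteq\{0,\dots,n\}$ write $\mathcal X_I=\mathcal X_{|I|-1}$, identifying $I$ with a standard ordinal. **Theorem.** The simplicial groupoid $\mathcal S_\bullet$ of flags in a proto-abelian category is 2-Segal. That is: 1. for every planar $(n+1)$-gon with vertices labelled cyclically by $0,1,\dots,n$ and every diagonal with end points $i<j$, the square $$\begin{array}{ccc}\mathcal S_{\{0,1,\dots,n\}} & \to & \mathcal S_{\{0,1,\dots,i,j,\dots,n\}}\\ \downarrow & & \downarrow\\ \mathcal S_{\{i,i+1,\dots,j\}}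 & \to & \mathcal S_{\{i,j\}}\end{array}$$ of restriction functors is a 2-pullback square; 2. for every $0\le i<n$, the square $$\begin{array}{ccc}\mathcal S_{\{0,1,\dots,n-1\}} & \to & \mathcal S_{\{i\}}\\ {\scriptstyle\sigma_i}\downarrow & & \downarrow\\ \mathcal S_{\{0,1,\dots,n\}} & \to & \mathcal S_{\{i,i+1\}}\end{array}$$ whose horizontal maps are restrictions and whose vertical maps are degeneracies, is a 2-pullback square. -/

import Mathlib

open CategoryTheory CategoryTheory.Limits Opposite

universe v u

/-- A category is *proto-abelian* if it has a zero object, every span `C' ↞ A ↪ B` can be completed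
to a pushout square and every cospan `C' ↪ D ↞ B` to a pullback square, both of the form
```
  A  ↪  B
  ↡     ↡
  C' ↪  D
```
(horizontal monomorphisms, vertical epimorphisms), and a commutative square of this form is a
pushout square if and only if it is a pullback square. -/
class ProtoAbelian (C : Type u) [Category.{v} C] : Prop where
  pointed : HasZeroObject C
  exists_isPushout : ∀ {A B C' : C} (f : A ⟶ B) (g : A ⟶ C'), Mono f → Epi g →
    ∃ (D : C) (h : B ⟶ D) (k : C' ⟶ D), Epi h ∧ Mono k ∧ IsPushout f g h k
  exists_isPullback : ∀ {B C' D : C} (h : B ⟶ D) (k : C' ⟶ D), Epi h → Mono k →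
    ∃ (A : C) (f : A ⟶ B) (g : A ⟶ C'), Mono f ∧ Epi g ∧ IsPullback f g h k
  isPushout_iff_isPullback : ∀ {A B C' D : C} (f : A ⟶ B) (g : A ⟶ C') (h : B ⟶ D) (k : C' ⟶ D),
    Mono f → Epi g → Epi h → Mono k → CommSq f g h k → (IsPushout f g h k ↔ IsPullback f g h k)

section FlagGroupoids

/-- The shape of the triangular diagrams: the poset of pairs `(i, j)` with
`0 ≤ i ≤ j ≤ n` (row `i`, column `j`), ordered componentwise. A functor from it to `C` is
a commutative triangular diagram `A_{i,j}`, with horizontal maps `A_{i,j} ⟶ A_{i,k}` for `j ≤ k`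
and vertical maps `A_{i,k} ⟶ A_{j,k}` for `i ≤ j`. -/
abbrev FlagShape (n : ℕ) : Type := {p : Fin (n + 1) × Fin (n + 1) // p.1 ≤ p.2}

namespace FlagShape

/-- The position in row `i` and column `j`. -/
abbrev pos {n : ℕ} (i j : Fin (n + 1)) (h : i ≤ j) : FlagShape n := ⟨(i, j), h⟩

/-- The horizontal arrow from `(i, j)` to `(i, k)`. -/
def right {n : ℕ} {i j k : Fin (n + 1)} (hij : i ≤ j) (hjk : j ≤ k) :
    pos i j hij ⟶ pos i k (hij.trans hjk) :=
  homOfLE ⟨le_rfl, hjk⟩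

/-- The vertical arrow from `(i, k)` to `(j, k)`. -/
def down {n : ℕ} {i j k : Fin (n + 1)} (hij : i ≤ j) (hjk : j ≤ k) :
    pos i k (hij.trans hjk) ⟶ pos j k hjk :=
  homOfLE ⟨hij, le_refl k⟩

/-- A monotone map acts on positions by `(i, j) ↦ (θ i, θ j)`. -/
def mapFunctor {m n : ℕ} (θ : Fin (m + 1) →o Fin (n + 1)) : FlagShape m ⥤ FlagShape n :=
  Monotone.functor (f := fun p ↦ pos (θ p.1.1) (θ p.1.2) (θ.monotone p.2))
    (fun _ _ h ↦ ⟨θ.monotone h.1, θ.monotone h.2⟩)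

end FlagShape

open FlagShape

variable {C : Type u} [Category.{v} C]

/-- The conditions on a triangular diagram to be a flag diagram with respect to the
fixed zero object `Z`: the diagonal entries are `Z`, horizontal maps are monomorphisms, vertical
maps are epimorphisms, and all squares are biCartesian. The latter is asked
for all rectangles with rows `i ≤ j` and columns `k ≤ l`; as biCartesian squares can be pasted, it
is the same as asking it for the elementary squares. -/
structure IsFlagDiagram (Z : C) {n : ℕ} (A : FlagShape n ⥤ C) : Prop where
  diag : ∀ i, A.obj (pos i i le_rfl) = Z
  mono : ∀ {i j k : Fin (n + 1)} (hij : i ≤ j) (hjk : j ≤ k), Mono (A.map (right hij hjk))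
  epi : ∀ {i j k : Fin (n + 1)} (hij : i ≤ j) (hjk : j ≤ k), Epi (A.map (down hij hjk))
  bicartesian : ∀ {i j k l : Fin (n + 1)} (hij : i ≤ j) (hjk : j ≤ k) (hkl : k ≤ l),
    BicartesianSq (A.map (right (hij.trans hjk) hkl)) (A.map (down hij hjk))
      (A.map (down hij (hjk.trans hkl))) (A.map (right hjk hkl))

/-- The category of flag diagrams of size `n`: the full subcategory of the category of
triangular diagrams. -/
abbrev FlagDiagram (Z : C) (n : ℕ) :=
  ObjectProperty.FullSubcategory (fun A : FlagShape n ⥤ C ↦ IsFlagDiagram Z A)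

lemma IsFlagDiagram.reindex {Z : C} {m n : ℕ} {A : FlagShape n ⥤ C} (hA : IsFlagDiagram Z A)
    (θ : Fin (m + 1) →o Fin (n + 1)) : IsFlagDiagram Z (mapFunctor θ ⋙ A) where
  diag i := hA.diag (θ i)
  mono hij hjk := hA.mono (θ.monotone hij) (θ.monotone hjk)
  epi hij hjk := hA.epi (θ.monotone hij) (θ.monotone hjk)
  bicartesian hij hjk hkl :=
    hA.bicartesian (θ.monotone hij) (θ.monotone hjk) (θ.monotone hkl)

/-- Reindexing of flag diagrams along a monotone map: the entry at `(i, j)` of the new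
diagram is `A_{θ i, θ j}`. For the injection that omits `k` this deletes the `k`-th row and
column, for the surjection that repeats `k` it doubles them. -/
def flagReindex (Z : C) {m n : ℕ} (θ : Fin (m + 1) →o Fin (n + 1)) :
    FlagDiagram Z n ⥤ FlagDiagram Z m :=
  ObjectProperty.lift _
    (ObjectProperty.ι _ ⋙ (Functor.whiskeringLeft _ _ C).obj (mapFunctor θ))
    (fun A ↦ A.property.reindex θ)

/-- The simplicial groupoid of flags: in degree `n` the maximal groupoid in the category of
flag diagrams of size `n`, with simplicial structure given by reindexing. -/
def flagGroupoids (Z : C) : SimplicialObject Grpd.{v, max u v} where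
  obj n := Grpd.of (Core (FlagDiagram Z n.unop.len))
  map θ := (flagReindex Z θ.unop.toOrderHom).core
  map_id _ := rfl
  map_comp _ _ := rfl

end FlagGroupoids

section TwoSegal

/-- The comparison functor `x ↦ (G' x, F' x, η x)` from a square of groupoids, commuting up to
the natural isomorphism `η`, to the 2-pullback of `F` and `G`, whose objects are the triples
`(a, b, φ : F a ≅ G b)`. -/
def toTwoPullback {X A B C : Grpd.{v, u}} {F' : X ⥤ B} {G' : X ⥤ A} {F : A ⥤ C} {G : B ⥤ C}
    (η : G' ⋙ F ≅ F' ⋙ G) : X ⥤ CategoricalPullback F G :=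
  (CategoricalPullback.CatCommSqOver.toFunctorToCategoricalPullback F G X).obj ⟨G', F', η⟩

/-- A strictly commuting square of groupoids
```
  X --F'--> B
  |         |
  G'        G
  v         v
  A --F-->  C
```
is a *2-pullback square* if the comparison functor to the 2-pullback, formed with the identity
isomorphism, is an equivalence. -/
structure IsTwoPullback {X A B C : Grpd.{v, u}} (F' : X ⟶ B) (G' : X ⟶ A) (G : B ⟶ C) (F : A ⟶ C) :
    Prop where
  comm : F' ≫ G = G' ≫ F
  isEquivalence : (toTwoPullback (F' := F') (G' := G') (F := F) (G := G)
    (eqToIso comm.symm)).IsEquivalence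

/-- The order embedding `[i + 1 + (n - j)] ⟶ [n]` with image `{0, …, i, j, …, n}`. -/
def outerPolygon {n : ℕ} (i j : ℕ) (hij : i < j) (hj : j ≤ n) :
    SimplexCategory.mk (i + 1 + (n - j)) ⟶ SimplexCategory.mk n :=
  SimplexCategory.mkHom
    { toFun := fun k ↦ ⟨if k.1 ≤ i then k.1 else j + (k.1 - (i + 1)), by
        have := k.2
        split_ifs <;> omega⟩
      monotone' := by
        intro k l hkl
        have h : k.1 ≤ l.1 := hkl
        simp only [Fin.mk_le_mk]
        split_ifs <;> omega }

/-- The order embedding `[j - i] ⟶ [n]` with image `{i, i + 1, …, j}`. -/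
def innerPolygon {n : ℕ} (i j : ℕ) (hij : i < j) (hj : j ≤ n) :
    SimplexCategory.mk (j - i) ⟶ SimplexCategory.mk n :=
  SimplexCategory.mkHom
    { toFun := fun k ↦ ⟨i + k.1, by have := k.2; omega⟩
      monotone' := by
        intro k l hkl
        have h : k.1 ≤ l.1 := hkl
        simp only [Fin.mk_le_mk]
        omega }

/-- The edge `{i, j}` of the polygon `{0, …, i, j, …, n}`. -/
def outerEdge {n : ℕ} (i j : ℕ) :
    SimplexCategory.mk 1 ⟶ SimplexCategory.mk (i + 1 + (n - j)) :=
  SimplexCategory.mkOfLe ⟨i, by omega⟩ ⟨i + 1, by omega⟩ (by simp)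

/-- The edge `{i, j}` of the polygon `{i, i + 1, …, j}`. -/
def innerEdge (i j : ℕ) : SimplexCategory.mk 1 ⟶ SimplexCategory.mk (j - i) :=
  SimplexCategory.diag (j - i)

/-- A simplicial groupoid is *2-Segal* if
* for every diagonal `{i, j}` of the `(n + 1)`-gon with vertices `0, …, n` (two non-adjacent
  vertices `i < j`), the square with corners `X_{0, …, n}`, `X_{0, …, i, j, …, n}`,
  `X_{i, …, j}`, `X_{i, j}` is a 2-pullback square;
* for all `0 ≤ i ≤ n`, the square with corners `X_{0, …, n}`, `X_{i}`, `X_{0, …, n + 1}`,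
  `X_{i, i + 1}`, whose vertical maps are degeneracies, is a 2-pullback square. -/
structure IsTwoSegal (X : SimplicialObject Grpd.{v, u}) : Prop where
  polygon : ∀ (n i j : ℕ) (hij : i + 1 < j) (hj : j ≤ n), ¬ (i = 0 ∧ j = n) →
    IsTwoPullback
      (X.map (outerPolygon i j (Nat.lt_of_succ_lt hij) hj).op)
      (X.map (innerPolygon i j (Nat.lt_of_succ_lt hij) hj).op)
      (X.map (outerEdge (n := n) i j).op)
      (X.map (innerEdge i j).op)
  degeneracy : ∀ (n : ℕ) (i : Fin (n + 1)),
    IsTwoPullback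
      (X.map (SimplexCategory.const (.mk 0) (.mk n) i).op)
      (X.map (SimplexCategory.σ i).op)
      (X.map (SimplexCategory.σ (0 : Fin 1)).op)
      (X.map (SimplexCategory.mkOfSucc i).op)

end TwoSegal

/-! ### Epimorphisms and monomorphisms in proto-abelian categories -/

namespace ProtoAbelian

variable {C : Type u} [Category.{v} C]

/-! A flag diagram is determined by its row `0`: the entry at `(i, j)` is the quotient of `A_{0,j}`
by `A_{0,i}`, so the diagram amounts to a flag of subobjects of its corner `A_{0,n}`
(`IsFlagDiagram.hom_ext`, `IsFlagDiagram.exists_hom`, `IsFlagDiagram.exists_of_subobjects`).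

For a diagonal `{i, j}`, the outer polygon records the steps of the flag up to `i` and from `j` on,
the inner polygon a flag in the quotient `A_{i,j}`. Pulling back along `A_{0,j} ↠ A_{i,j}` turns the
latter into a flag between `A_{0,i}` and `A_{0,j}`; inserting it refines the outer flag to full
length (`IsDiagonalCut.exists_glue`). That the refined flag induces the given inner one rests on
uniqueness of epi-mono factorisations, which holds because every epimorphism is the cokernel of its
kernel.

For the degeneracy square, a point of the 2-pullback is a diagram with `A_{i,i+1}` zero. BiCartesian
squares then make the maps between rows, and between columns, `i` and `i + 1` invertible, so
deleting row and column `i + 1` inverts the degeneracy up to isomorphism. -/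

lemma epi_to_isZero {X Z : C} (hZ : IsZero Z) (f : X ⟶ Z) : Epi f where
  left_cancellation _ _ _ := hZ.eq_of_src _ _

lemma mono_from_isZero {X Z : C} (hZ : IsZero Z) (f : Z ⟶ X) : Mono f where
  right_cancellation _ _ _ := hZ.eq_of_tgt _ _

variable [ProtoAbelian C]

/-- In a proto-abelian category, the pushout of a monomorphism along an epimorphism
is a monomorphism. -/
lemma mono_of_isPushout {A B C' D : C} {f : A ⟶ B} {g : A ⟶ C'} {h : B ⟶ D} {k : C' ⟶ D}
    (sq : IsPushout f g h k) (hf : Mono f) (hg : Epi g) : Mono k := by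
  -- Pushouts are unique up to isomorphism, so it suffices to know one with a monic leg.
  obtain ⟨D', h', k', -, hk', sq'⟩ := exists_isPushout f g hf hg
  have : k ≫ (sq.isoIsPushout _ _ sq').hom = k' := by simp
  exact mono_of_mono_fac this

/-- In a proto-abelian category, every epimorphism lifts against every monomorphism. -/
lemma exists_lift {X Y A B : C} (hZ : HasZeroObject C) {e : X ⟶ Y} {m : A ⟶ B} (he : Epi e)
    (hm : Mono m) {x : X ⟶ A} {y : Y ⟶ B} (w : e ≫ y = x ≫ m) : ∃ d : Y ⟶ A, d ≫ m = y := by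
  obtain ⟨Z, hZ⟩ := hZ
  -- `K` is the kernel of `e`. Its square is also a pushout, so `e` is the cokernel of `i`; and `x`
  -- kills `K` because `x ≫ m` does and `m` is monic.
  obtain ⟨K, i, p, hi, hp, sq⟩ := exists_isPullback e (hZ.to_ Y) he (mono_from_isZero hZ _)
  have sq' := (isPushout_iff_isPullback i p e _ hi hp he (mono_from_isZero hZ _) ⟨sq.w⟩).2 sq
  have h : i ≫ x = p ≫ hZ.to_ A := by
    rw [← cancel_mono m, Category.assoc, ← w, ← Category.assoc, sq.w, Category.assoc,
      Category.assoc, hZ.eq_of_src (hZ.to_ Y ≫ y) (hZ.to_ A ≫ m)]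
  refine ⟨sq'.desc x (hZ.to_ A) h, ?_⟩
  rw [← cancel_epi e, ← Category.assoc, sq'.inl_desc, w]

/-- Factorisations into an epimorphism and a monomorphism are unique up to isomorphism. -/
lemma exists_iso_of_factorisations {X Y Y' B : C} {e : X ⟶ Y} {m : Y ⟶ B} {e' : X ⟶ Y'}
    {m' : Y' ⟶ B} (he : Epi e) (he' : Epi e') (hm : Mono m) (hm' : Mono m')
    (w : e ≫ m = e' ≫ m') : ∃ f : Y ≅ Y', f.hom ≫ m' = m := by
  obtain ⟨f, hf⟩ := exists_lift pointed he hm' w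
  obtain ⟨g, hg⟩ := exists_lift pointed he' hm w.symm
  refine ⟨⟨f, g, ?_, ?_⟩, hf⟩
  · rw [← cancel_mono m, Category.assoc, hg, hf, Category.id_comp]
  · rw [← cancel_mono m', Category.assoc, hf, hg, Category.id_comp]

lemma bicartesianSq_of_isPushout {A B C' D : C} {f : A ⟶ B} {g : A ⟶ C'} {h : B ⟶ D} {k : C' ⟶ D}
    (sq : IsPushout f g h k) (hf : Mono f) (hg : Epi g) (hh : Epi h) (hk : Mono k) :
    BicartesianSq f g h k :=
  .of_isPullback_isPushout ((isPushout_iff_isPullback f g h k hf hg hh hk ⟨sq.w⟩).1 sq) sq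

end ProtoAbelian

/-! ### Flag diagrams and the chains in their row `0` -/

namespace IsFlagDiagram

open FlagShape ProtoAbelian

variable {C : Type u} [Category.{v} C] {Z : C} {n : ℕ} {A B : FlagShape n ⥤ C}

/-- After reindexing, positions often share a row or column only propositionally; this and the next
lemmas restate the flag conditions for arbitrary arrows of the shape. -/
lemma mono_map (hA : IsFlagDiagram Z A) {p q : FlagShape n} (f : p ⟶ q) (h : p.1.1 = q.1.1) :
    Mono (A.map f) := by
  obtain ⟨⟨i, j⟩, hij⟩ := p
  obtain ⟨⟨i', k⟩, hik⟩ := q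
  obtain rfl : i = i' := h
  exact hA.mono hij (leOfHom f).2

lemma epi_map (hA : IsFlagDiagram Z A) {p q : FlagShape n} (f : p ⟶ q) (h : p.1.2 = q.1.2) :
    Epi (A.map f) := by
  obtain ⟨⟨i, k⟩, hik⟩ := p
  obtain ⟨⟨j, k'⟩, hjk⟩ := q
  obtain rfl : k = k' := h
  exact hA.epi (leOfHom f).1 hjk

lemma bicartesianSq_map (hA : IsFlagDiagram Z A) {p q r s : FlagShape n} (pq : p ⟶ q) (pr : p ⟶ r)
    (qs : q ⟶ s) (rs : r ⟶ s) (hpq : p.1.1 = q.1.1) (hrs : r.1.1 = s.1.1) (hpr : p.1.2 = r.1.2)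
    (hqs : q.1.2 = s.1.2) : BicartesianSq (A.map pq) (A.map pr) (A.map qs) (A.map rs) := by
  obtain ⟨⟨i, k⟩, hik⟩ := p
  obtain ⟨⟨i', l⟩, hil⟩ := q
  obtain ⟨⟨j, k'⟩, hjk⟩ := r
  obtain ⟨⟨j', l'⟩, hjl⟩ := s
  obtain rfl : i = i' := hpq
  obtain rfl : j = j' := hrs
  obtain rfl : k = k' := hpr
  obtain rfl : l = l' := hqs
  exact hA.bicartesian (leOfHom pr).1 hjk (leOfHom pq).2

lemma isZero_obj (hA : IsFlagDiagram Z A) (hZ : IsZero Z) {p : FlagShape n} (h : p.1.1 = p.1.2) :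
    IsZero (A.obj p) := by
  obtain ⟨⟨i, j⟩, hij⟩ := p
  obtain rfl : i = j := h
  rw [hA.diag]
  exact hZ

/-- The entry in row `0` above `p`. -/
abbrev row {n : ℕ} (p : FlagShape n) : FlagShape n := pos 0 p.1.2 (Fin.zero_le _)

lemma row_le {n : ℕ} (p : FlagShape n) : row p ≤ p := ⟨Fin.zero_le _, le_rfl⟩

lemma le_top {n : ℕ} {p t : FlagShape n} (hp : p.1.1 = 0) (ht : t.1.2 = Fin.last n) : p ≤ t :=
  ⟨hp ▸ Fin.zero_le _, ht ▸ Fin.le_last _⟩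

/-- Morphisms of flag diagrams agree if they agree in the top right corner. -/
lemma hom_ext (hA : IsFlagDiagram Z A) (hB : IsFlagDiagram Z B) {σ τ : A ⟶ B} (t : FlagShape n)
    (ht0 : t.1.1 = 0) (ht : t.1.2 = Fin.last n) (h : σ.app t = τ.app t) : σ = τ := by
  ext p
  have := hA.epi_map (homOfLE (row_le p)) rfl
  have := hB.mono_map (homOfLE (le_top (p := row p) rfl ht)) ht0.symm
  rw [← cancel_epi (A.map (homOfLE (row_le p))), σ.naturality, τ.naturality]
  congr 1
  rw [← cancel_mono (B.map (homOfLE (le_top (p := row p) rfl ht))), ← σ.naturality,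
    ← τ.naturality, h]

/-- A morphism between the top right corners that is compatible with the flags in row `0`
extends to a morphism of flag diagrams. -/
lemma exists_hom (hA : IsFlagDiagram Z A) (hB : IsFlagDiagram Z B) (hZ : IsZero Z)
    (t : FlagShape n) (ht0 : t.1.1 = 0) (ht : t.1.2 = Fin.last n) (g : A.obj t ⟶ B.obj t)
    (hg : ∀ (p : FlagShape n) (hp : p.1.1 = 0), ∃ f : A.obj p ⟶ B.obj p,
      f ≫ B.map (homOfLE (le_top hp ht)) = A.map (homOfLE (le_top hp ht)) ≫ g) :
    ∃ τ : A ⟶ B, τ.app t = g := by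
  choose f hf using hg
  -- Row `0` of `B` embeds in the corner, which makes the maps `f` natural along the row.
  have nat {p q : FlagShape n} (hp : p.1.1 = 0) (hq : q.1.1 = 0) (a : p ⟶ q) :
      A.map a ≫ f q hq = f p hp ≫ B.map a := by
    have := hB.mono_map (homOfLE (le_top hq ht)) (hq.trans ht0.symm)
    rw [← cancel_mono (B.map (homOfLE (le_top hq ht))), Category.assoc, Category.assoc, hf,
      ← A.map_comp_assoc, ← B.map_comp]
    exact (hf p hp).symm
  -- `A.obj p` is the cokernel of `A.obj p₀ ⟶ A.obj (row p)`, so `f (row p)` descends to it.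
  have key (p : FlagShape n) : ∃ φ : A.obj p ⟶ B.obj p,
      A.map (homOfLE (row_le p)) ≫ φ = f (row p) rfl ≫ B.map (homOfLE (row_le p)) := by
    let p₀ : FlagShape n := pos 0 p.1.1 (Fin.zero_le _)
    let d : FlagShape n := pos p.1.1 p.1.1 le_rfl
    have h1 : p₀ ≤ row p := ⟨le_rfl, p.2⟩
    have h2 : p₀ ≤ d := ⟨Fin.zero_le _, le_rfl⟩
    have h3 : d ≤ p := ⟨le_rfl, p.2⟩
    have sq := (hA.bicartesianSq_map (homOfLE h1) (homOfLE h2) (homOfLE (row_le p))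
      (homOfLE h3) rfl rfl rfl rfl).toIsPushout
    have zA : IsZero (A.obj d) := hA.isZero_obj hZ rfl
    have zB : IsZero (B.obj d) := hB.isZero_obj hZ rfl
    refine ⟨sq.desc (f (row p) rfl ≫ B.map (homOfLE (row_le p)))
      (zA.to_ (B.obj d) ≫ B.map (homOfLE h3)) ?_, sq.inl_desc _ _ _⟩
    have e : A.map (homOfLE h2) ≫ zA.to_ (B.obj d) = f p₀ rfl ≫ B.map (homOfLE h2) :=
      zB.eq_of_tgt _ _
    rw [← Category.assoc, nat (p := p₀) rfl rfl, ← Category.assoc, e, Category.assoc,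
      Category.assoc, ← B.map_comp, ← B.map_comp]
    rfl
  choose φ hφ using key
  refine ⟨{ app := φ, naturality := ?_ }, ?_⟩
  · intro p q a
    have := hA.epi_map (homOfLE (row_le p)) rfl
    have hpq : row p ≤ row q := ⟨le_rfl, (leOfHom a).2⟩
    have e : homOfLE (row_le p) ≫ a = homOfLE hpq ≫ homOfLE (row_le q) := rfl
    rw [← cancel_epi (A.map (homOfLE (row_le p))), ← A.map_comp_assoc, ← Category.assoc, hφ, e,
      A.map_comp, Category.assoc, hφ, ← Category.assoc, nat (p := row p) rfl rfl, Category.assoc,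
      Category.assoc, ← B.map_comp, ← B.map_comp]
    rfl
  · obtain ⟨⟨i, j⟩, hij⟩ := t
    obtain rfl : i = 0 := ht0
    obtain rfl : j = Fin.last n := ht
    have h1 := hφ (pos 0 (Fin.last n) hij)
    have h2 := hf (pos 0 (Fin.last n) hij) rfl
    have e : homOfLE (row_le (pos 0 (Fin.last n) hij)) = 𝟙 _ := rfl
    have e' : homOfLE (le_top (p := pos 0 (Fin.last n) hij) rfl rfl) = 𝟙 (pos 0 (Fin.last n) hij) := rfl
    rw [e] at h1
    rw [e'] at h2
    rw [A.map_id, Category.id_comp, B.map_id, Category.comp_id] at h1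
    rw [A.map_id, Category.id_comp, B.map_id, Category.comp_id] at h2
    exact h1.trans h2

/-- An isomorphism between the top right corners that is compatible with the flags in row `0`
extends to an isomorphism of flag diagrams. -/
lemma exists_iso (hA : IsFlagDiagram Z A) (hB : IsFlagDiagram Z B) (hZ : IsZero Z)
    (t : FlagShape n) (ht0 : t.1.1 = 0) (ht : t.1.2 = Fin.last n) (g : A.obj t ≅ B.obj t)
    (hg : ∀ (p : FlagShape n) (hp : p.1.1 = 0), ∃ f : A.obj p ≅ B.obj p,
      f.hom ≫ B.map (homOfLE (le_top hp ht)) = A.map (homOfLE (le_top hp ht)) ≫ g.hom) :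
    ∃ τ : A ≅ B, τ.hom.app t = g.hom := by
  obtain ⟨τ, hτ⟩ := hA.exists_hom hB hZ t ht0 ht g.hom fun p hp ↦ by
    obtain ⟨f, hf⟩ := hg p hp
    exact ⟨f.hom, hf⟩
  obtain ⟨σ, hσ⟩ := hB.exists_hom hA hZ t ht0 ht g.inv fun p hp ↦ by
    obtain ⟨f, hf⟩ := hg p hp
    refine ⟨f.inv, ?_⟩
    rw [Iso.inv_comp_eq, ← Category.assoc, Iso.eq_comp_inv, hf]
  exact ⟨⟨τ, σ, hA.hom_ext hA t ht0 ht (by simp [hτ, hσ]),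
    hB.hom_ext hB t ht0 ht (by simp [hτ, hσ])⟩, hτ⟩

/-- The quotients of a chain of monomorphisms that starts with a zero object form a flag diagram,
whose row `0` is isomorphic to the chain. -/
lemma exists_of_chain [ProtoAbelian C] (hZ : IsZero Z) (X : Fin (n + 1) ⥤ C)
    (hX : ∀ {k l : Fin (n + 1)} (a : k ⟶ l), Mono (X.map a)) (hX0 : IsZero (X.obj 0)) :
    ∃ A : FlagShape n ⥤ C, IsFlagDiagram Z A ∧ ∃ e : ∀ p : FlagShape n, X.obj p.1.2 ⟶ A.obj p,
      (∀ {p q : FlagShape n} (a : p ⟶ q),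
        e p ≫ A.map a = X.map (homOfLE (leOfHom a).2) ≫ e q) ∧
      ∀ p, p.1.1 = 0 → IsIso (e p) := by
  have key (p : FlagShape n) : ∃ (D : C) (h : X.obj p.1.2 ⟶ D) (z : Z ⟶ D),
      IsPushout (X.map (homOfLE p.2)) (hZ.from_ (X.obj p.1.1)) h z ∧ Epi h ∧
        (p.1.1 = p.1.2 → D = Z) := by
    -- Diagonal entries must equal `Z`, not just be isomorphic to it, so there the pushout is chosen
    -- by hand.
    by_cases hp : p.1.1 = p.1.2
    · obtain ⟨⟨i, j⟩, hij⟩ := p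
      obtain rfl : i = j := hp
      refine ⟨Z, hZ.from_ _, 𝟙 Z, ?_, epi_to_isZero hZ _, fun _ ↦ rfl⟩
      have : homOfLE hij = 𝟙 i := rfl
      rw [this, X.map_id]
      exact IsPushout.of_horiz_isIso ⟨by simp⟩
    · obtain ⟨D, h, z, hh, -, sq⟩ := ProtoAbelian.exists_isPushout (X.map (homOfLE p.2))
        (hZ.from_ (X.obj p.1.1)) (hX _) (epi_to_isZero hZ _)
      exact ⟨D, h, z, sq, hh, fun h ↦ (hp h).elim⟩
  choose D e z sq he hD using key
  have key {p q : FlagShape n} (a : p ⟶ q) : ∃ φ : D p ⟶ D q,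
      e p ≫ φ = X.map (homOfLE (leOfHom a).2) ≫ e q := by
    refine ⟨(sq p).desc (X.map (homOfLE (leOfHom a).2) ≫ e q) (z q) ?_, (sq p).inl_desc _ _ _⟩
    have : X.map (homOfLE p.2) ≫ X.map (homOfLE (leOfHom a).2) =
        X.map (homOfLE (leOfHom a).1) ≫ X.map (homOfLE q.2) := by
      rw [← X.map_comp, ← X.map_comp]
      rfl
    rw [← Category.assoc, this, Category.assoc, (sq q).w, ← Category.assoc,
      hZ.eq_of_tgt (X.map (homOfLE (leOfHom a).1) ≫ hZ.from_ (X.obj q.1.1)) (hZ.from_ _)]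
  choose φ hφ using @key
  let A : FlagShape n ⥤ C :=
    { obj := D
      map := φ
      map_id := fun p ↦ by
        have := he p
        have h : homOfLE (leOfHom (𝟙 p)).2 = 𝟙 p.1.2 := rfl
        rw [← cancel_epi (e p), hφ, h, X.map_id, Category.id_comp, Category.comp_id]
      map_comp := fun {p q r} a b ↦ by
        have := he p
        rw [← cancel_epi (e p), hφ, ← Category.assoc, hφ, Category.assoc, hφ, ← Category.assoc,
          ← X.map_comp]
        rfl }
  -- Cancel the pushout defining `D p` from the one defining `D q`.
  have horiz {p q : FlagShape n} (a : p ⟶ q) (hpq : p.1.1 = q.1.1) :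
      IsPushout (X.map (homOfLE (leOfHom a).2)) (e p) (e q) (A.map a) := by
    obtain ⟨⟨i, j⟩, hij⟩ := p
    obtain ⟨⟨i', k⟩, hik⟩ := q
    obtain rfl : i = i' := hpq
    refine IsPushout.of_left ?_ (hφ a).symm (sq _)
    have h1 : z ⟨(i, j), hij⟩ ≫ A.map a = z ⟨(i, k), hik⟩ := hZ.eq_of_src _ _
    rw [← X.map_comp, h1]
    exact sq ⟨(i, k), hik⟩
  have epi {p q : FlagShape n} (a : p ⟶ q) (hpq : p.1.2 = q.1.2) : Epi (A.map a) := by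
    obtain ⟨⟨i, k⟩, hik⟩ := p
    obtain ⟨⟨j, k'⟩, hjk⟩ := q
    obtain rfl : k = k' := hpq
    have h : homOfLE (leOfHom a).2 = 𝟙 k := rfl
    have h1 := hφ a
    have := he ⟨(j, k), hjk⟩
    rw [h, X.map_id, Category.id_comp] at h1
    exact epi_of_epi_fac h1
  have mono {p q : FlagShape n} (a : p ⟶ q) (hpq : p.1.1 = q.1.1) : Mono (A.map a) :=
    mono_of_isPushout (horiz a hpq) (hX _) (he _)
  refine ⟨A, ⟨fun i ↦ hD _ rfl, fun _ _ ↦ mono _ rfl, fun _ _ ↦ epi _ rfl, ?_⟩, e, hφ, ?_⟩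
  · intro i j k l hij hjk hkl
    -- The squares from the chain to row `i` and to row `j` are pushouts; cancelling the first
    -- leaves the square between the two rows.
    refine bicartesianSq_of_isPushout (IsPushout.of_top ?_ ?_ (horiz (right _ _) rfl)) (mono _ rfl)
      (epi _ rfl) (epi _ rfl) (mono _ rfl)
    · have h1 := hφ (down hij hjk)
      have h2 := hφ (down hij (hjk.trans hkl))
      have e1 : homOfLE (leOfHom (down hij hjk)).2 = 𝟙 k := rfl
      have e2 : homOfLE (leOfHom (down hij (hjk.trans hkl))).2 = 𝟙 l := rfl
      rw [e1, X.map_id, Category.id_comp] at h1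
      rw [e2, X.map_id, Category.id_comp] at h2
      change IsPushout _ (_ ≫ φ _) (_ ≫ φ _) _
      rw [h1, h2]
      exact horiz (right hjk hkl) rfl
    · rw [← A.map_comp, ← A.map_comp]
      rfl
  · rintro ⟨⟨i, j⟩, hij⟩ hi
    obtain rfl : i = 0 := hi
    have : IsIso (hZ.from_ (X.obj 0)) := by
      rw [hZ.eq_of_tgt (hZ.from_ (X.obj 0)) (hX0.iso hZ).hom]
      infer_instance
    exact (sq _).isIso_inl_of_isIso

/-- A chain of subobjects of `W` that starts with a zero object and ends with `W` is the row `0`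
of a flag diagram. -/
lemma exists_of_subobjects [ProtoAbelian C] (hZ : IsZero Z) {W : C} (s : Fin (n + 1) →o Subobject W)
    (h0 : IsZero (s 0 : C)) (hn : s (Fin.last n) = ⊤) (t : FlagShape n) (ht0 : t.1.1 = 0)
    (ht : t.1.2 = Fin.last n) :
    ∃ A : FlagShape n ⥤ C, IsFlagDiagram Z A ∧ ∃ w : A.obj t ≅ W,
      ∀ (p : FlagShape n) (hp : p.1.1 = 0), ∃ f : A.obj p ≅ (s p.1.2 : C),
        f.hom ≫ (s p.1.2).arrow = A.map (homOfLE (le_top hp ht)) ≫ w.hom := by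
  let X : Fin (n + 1) ⥤ C := s.monotone.functor ⋙ Subobject.underlying
  let arr (k : Fin (n + 1)) : X.obj k ⟶ W := (s k).arrow
  have harr (k : Fin (n + 1)) : Mono (arr k) := inferInstanceAs (Mono (s k).arrow)
  have hX {k l : Fin (n + 1)} (a : k ⟶ l) : X.map a ≫ arr l = arr k :=
    Subobject.underlying_arrow _
  obtain ⟨A, hA, e, he, hiso⟩ := exists_of_chain hZ X (fun a ↦ mono_of_mono_fac (hX a)) h0
  have : IsIso (e t) := hiso t ht0
  have : IsIso (arr t.1.2) := by
    change IsIso (s t.1.2).arrow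
    rw [ht, hn]
    infer_instance
  refine ⟨A, hA, (asIso (e t)).symm ≪≫ asIso (arr t.1.2), fun p hp ↦ ?_⟩
  have := hiso p hp
  refine ⟨(asIso (e p)).symm, ?_⟩
  change inv (e p) ≫ arr p.1.2 = _ ≫ inv (e t) ≫ arr t.1.2
  rw [IsIso.inv_comp_eq, ← Category.assoc, he, Category.assoc, IsIso.hom_inv_id_assoc, hX]

end IsFlagDiagram

/-! ### Gluing flag diagrams along a diagonal -/

open FlagShape ProtoAbelian IsFlagDiagram

/-- The index maps `o` and `ι` exhibit `{0, …, n}` as the union of an outer and an inner polygon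
with common edge `p` in the outer polygon and `q` in the inner polygon. -/
structure IsDiagonalCut {n N M : ℕ} (o : Fin (N + 1) →o Fin (n + 1)) (ι : Fin (M + 1) →o Fin (n + 1))
    (p : FlagShape N) (q : FlagShape M) : Prop where
  map_zero : o 0 = 0
  map_last : o (Fin.last N) = Fin.last n
  fst_eq : q.1.1 = 0
  snd_eq : q.1.2 = Fin.last M
  obj_eq : (mapFunctor o).obj p = (mapFunctor ι).obj q
  le_or_le : ∀ k, k ≤ p.1.1 ∨ p.1.2 ≤ k
  cover : ∀ l, (∃ k, o k = l) ∨ ∃ k, ι k = l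
  le_of_outer : ∀ k l, o k ≤ o l → k ≤ l
  le_of_inner : ∀ k l, ι k ≤ ι l → k ≤ l

section

variable {C : Type u} [Category.{v} C] {Z : C}

/-- Equal positions are compared through the order arrow between them rather than by transport along
the equality. -/
lemma isIso_map_of_le {P : Type*} [PartialOrder P] (A : P ⥤ C) {p q : P} (f : p ⟶ q)
    (h : q ≤ p) : IsIso (A.map f) :=
  ⟨A.map (homOfLE h), by rw [← A.map_comp, ← A.map_id]; rfl,
    by rw [← A.map_comp, ← A.map_id]; rfl⟩

namespace IsDiagonalCut

variable {n N M : ℕ} {o : Fin (N + 1) →o Fin (n + 1)} {ι : Fin (M + 1) →o Fin (n + 1)}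
  {p : FlagShape N} {q : FlagShape M}

lemma outer_fst (h : IsDiagonalCut o ι p q) : o p.1.1 = ι 0 := by
  rw [← h.fst_eq]
  exact congrArg (fun x ↦ x.1.1) h.obj_eq

lemma outer_snd (h : IsDiagonalCut o ι p q) : o p.1.2 = ι (Fin.last M) := by
  rw [← h.snd_eq]
  exact congrArg (fun x ↦ x.1.2) h.obj_eq

/-- A flag diagram is determined by its restrictions to the outer and the inner polygon:
the case of morphisms. -/
lemma exists_hom (h : IsDiagonalCut o ι p q) (hZ : IsZero Z) {A B : FlagShape n ⥤ C}
    (hA : IsFlagDiagram Z A) (hB : IsFlagDiagram Z B)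
    (σ : mapFunctor ι ⋙ A ⟶ mapFunctor ι ⋙ B) (τ : mapFunctor o ⋙ A ⟶ mapFunctor o ⋙ B)
    (w : A.map (homOfLE h.obj_eq.le) ≫ σ.app q = τ.app p ≫ B.map (homOfLE h.obj_eq.le)) :
    ∃ ρ : A ⟶ B, Functor.whiskerLeft (mapFunctor ι) ρ = σ ∧
      Functor.whiskerLeft (mapFunctor o) ρ = τ := by
  let t : FlagShape N := pos 0 (Fin.last N) (Fin.zero_le _)
  obtain ⟨ρ, hρ⟩ := hA.exists_hom hB hZ ((mapFunctor o).obj t) h.map_zero h.map_last (τ.app t)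
    fun r hr ↦ by
      obtain ⟨k, hk⟩ | ⟨k, hk⟩ := h.cover r.1.2
      · obtain rfl : r = (mapFunctor o).obj (pos 0 k (Fin.zero_le _)) :=
          Subtype.ext (Prod.ext (hr.trans h.map_zero.symm) hk.symm)
        have hkt : pos 0 k (Fin.zero_le _) ≤ t := ⟨le_rfl, Fin.le_last _⟩
        exact ⟨τ.app (pos 0 k (Fin.zero_le _)), (τ.naturality (homOfLE hkt)).symm⟩
      · let x : FlagShape N := pos 0 p.1.2 (Fin.zero_le _)
        let y : FlagShape M := pos 0 k (Fin.zero_le _)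
        have hxp : x ≤ p := ⟨Fin.zero_le _, le_rfl⟩
        have hxt : x ≤ t := ⟨le_rfl, Fin.le_last _⟩
        have hyq : y ≤ q := ⟨Fin.zero_le _, h.snd_eq.symm ▸ Fin.le_last _⟩
        have hrx : r ≤ (mapFunctor o).obj x := ⟨hr ▸ Fin.zero_le _, by
          change _ ≤ o p.1.2
          rw [h.outer_snd, ← hk]
          exact ι.monotone (Fin.le_last _)⟩
        have hry : r ≤ (mapFunctor ι).obj y := ⟨hr ▸ Fin.zero_le _, hk.symm.le⟩
        -- `B.obj r` is the preimage, in the outer entry at `x`, of the inner entry at `y`; `τ` and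
        -- `σ` agree over the common edge by `w`.
        have sq := (hB.bicartesianSq_map (homOfLE hrx) (homOfLE hry)
          ((mapFunctor o).map (homOfLE hxp) ≫ homOfLE h.obj_eq.le)
          ((mapFunctor ι).map (homOfLE hyq)) (hr.trans h.map_zero.symm)
          (congrArg ι h.fst_eq.symm) hk.symm
          (congrArg (fun z ↦ z.1.2) h.obj_eq)).toIsPullback
        refine ⟨sq.lift (A.map (homOfLE hrx) ≫ τ.app x) (A.map (homOfLE hry) ≫ σ.app y) ?_, ?_⟩
        · have e1 := τ.naturality (homOfLE hxp)
          have e2 := σ.naturality (homOfLE hyq)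
          simp only [Functor.comp_map] at e1 e2
          rw [Category.assoc, B.map_comp, ← Category.assoc (τ.app x), ← e1, Category.assoc,
            Category.assoc, ← e2, ← w, ← A.map_comp_assoc, ← A.map_comp_assoc, ← A.map_comp_assoc]
          rfl
        · have e := τ.naturality (homOfLE hxt)
          simp only [Functor.comp_map] at e
          have e' (F : FlagShape n ⥤ C) :
              F.map (homOfLE (le_top (t := (mapFunctor o).obj t) hr h.map_last)) =
                F.map (homOfLE hrx) ≫ F.map ((mapFunctor o).map (homOfLE hxt)) :=
            F.map_comp _ _
          rw [e', e', ← Category.assoc, sq.lift_fst, Category.assoc, Category.assoc, e]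
  have ho : Functor.whiskerLeft (mapFunctor o) ρ = τ :=
    (hA.reindex o).hom_ext (hB.reindex o) t rfl rfl hρ
  refine ⟨ρ, (hA.reindex ι).hom_ext (hB.reindex ι) q h.fst_eq h.snd_eq ?_, ho⟩
  have := isIso_map_of_le A (homOfLE h.obj_eq.le) h.obj_eq.ge
  rw [← cancel_epi (A.map (homOfLE h.obj_eq.le)), w, ← ho]
  exact ρ.naturality _

/-- Flag diagrams on the outer and the inner polygon that agree on the common edge can be glued. -/
lemma exists_glue [ProtoAbelian C] (h : IsDiagonalCut o ι p q) (hZ : IsZero Z)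
    {a : FlagShape M ⥤ C} {b : FlagShape N ⥤ C} (ha : IsFlagDiagram Z a) (hb : IsFlagDiagram Z b)
    (c : b.obj p ≅ a.obj q) :
    ∃ A : FlagShape n ⥤ C, IsFlagDiagram Z A ∧ ∃ (σ : mapFunctor ι ⋙ A ≅ a)
      (τ : mapFunctor o ⋙ A ≅ b),
      A.map (homOfLE h.obj_eq.le) ≫ σ.hom.app q = τ.hom.app p ≫ c.hom := by
  let t : FlagShape N := pos 0 (Fin.last N) (Fin.zero_le _)
  let x (k : Fin (N + 1)) : FlagShape N := pos 0 k (Fin.zero_le _)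
  let y (k : Fin (M + 1)) : FlagShape M := pos 0 k (Fin.zero_le _)
  have hxt (k) : x k ≤ t := ⟨le_rfl, Fin.le_last _⟩
  have hyq (k) : y k ≤ q := ⟨Fin.zero_le _, h.snd_eq.symm ▸ Fin.le_last _⟩
  have hxp : x p.1.2 ≤ p := ⟨Fin.zero_le _, le_rfl⟩
  let β (k) : b.obj (x k) ⟶ b.obj t := b.map (homOfLE (hxt k))
  have hβ (k) : Mono (β k) := hb.mono_map _ rfl
  let α (k) : a.obj (y k) ⟶ a.obj q := a.map (homOfLE (hyq k))
  have hα (k) : Mono (α k) := ha.mono_map _ h.fst_eq.symm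
  let π : b.obj (x p.1.2) ⟶ a.obj q := b.map (homOfLE hxp) ≫ c.hom
  have hπ : Epi π := by
    have := hb.epi_map (homOfLE hxp) rfl
    exact epi_comp _ _
  -- `P k` is the preimage under the quotient map `π` of the `k`-th step of the inner flag.
  choose P r g hr hg sqP using fun k ↦ ProtoAbelian.exists_isPullback π (α k) hπ (hα k)
  let O (k) : Subobject (b.obj t) := Subobject.mk (β k)
  let I (k) : Subobject (b.obj t) := Subobject.mk (r k ≫ β p.1.2)
  have O_mono {k l} (hkl : k ≤ l) : O k ≤ O l := by
    have hx : x k ≤ x l := ⟨le_rfl, hkl⟩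
    exact Subobject.mk_le_mk_of_comm (b.map (homOfLE hx)) (b.map_comp _ _).symm
  have I_mono {k l} (hkl : k ≤ l) : I k ≤ I l := by
    have hy : y k ≤ y l := ⟨le_rfl, hkl⟩
    have e : a.map (homOfLE hy) ≫ α l = α k := (a.map_comp _ _).symm
    refine Subobject.mk_le_mk_of_comm
      ((sqP l).lift (r k) (g k ≫ a.map (homOfLE hy)) ?_) ?_
    · rw [(sqP k).w, Category.assoc, e]
    · rw [← Category.assoc, (sqP l).lift_fst]
  -- The preimage of zero is the kernel of `π`, which is the outer step where the diagonal starts.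
  have I_zero : I 0 = O p.1.1 := by
    let d : FlagShape N := pos p.1.1 p.1.1 le_rfl
    have h1 : x p.1.1 ≤ x p.1.2 := ⟨le_rfl, p.2⟩
    have h2 : x p.1.1 ≤ d := ⟨Fin.zero_le _, le_rfl⟩
    have h3 : d ≤ p := ⟨le_rfl, p.2⟩
    have zb : IsZero (b.obj d) := hb.isZero_obj hZ rfl
    have za : IsZero (a.obj (y 0)) := ha.isZero_obj hZ rfl
    have sq : IsPullback (b.map (homOfLE h1)) (b.map (homOfLE h2) ≫ (zb.iso za).hom) π (α 0) :=
      (hb.bicartesianSq_map (homOfLE h1) (homOfLE h2) (homOfLE hxp) (homOfLE h3) rfl rfl rfl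
        rfl).toIsPullback.paste_vert (IsPullback.of_vert_isIso ⟨zb.eq_of_src _ _⟩)
    refine Subobject.mk_eq_mk_of_comm _ _ ((sqP 0).isoIsPullback _ _ sq) ?_
    have e : β p.1.1 = b.map (homOfLE h1) ≫ β p.1.2 := b.map_comp _ _
    rw [e, ← Category.assoc, IsPullback.isoIsPullback_hom_fst]
  have I_last : I (Fin.last M) = O p.1.2 := by
    have : IsIso (α (Fin.last M)) := isIso_map_of_le _ _ ⟨h.fst_eq.le, h.snd_eq.le⟩
    have := (sqP (Fin.last M)).isIso_fst_of_isIso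
    exact Subobject.mk_eq_mk_of_comm _ _ (asIso (r (Fin.last M))) rfl
  -- The polygons share only the end points of the diagonal.
  have overlap {k l} (hkl : o k = ι l) : O k = I l := by
    obtain hk | hk := h.le_or_le k
    · obtain rfl : l = 0 := le_antisymm
        (h.le_of_inner _ _ (by rw [← hkl, ← h.outer_fst]; exact o.monotone hk)) (Fin.zero_le _)
      obtain rfl : k = p.1.1 := le_antisymm hk
        (h.le_of_outer _ _ (by rw [hkl, h.outer_fst]))
      exact I_zero.symm
    · obtain rfl : l = Fin.last M := le_antisymm (Fin.le_last _)
        (h.le_of_inner _ _ (by rw [← hkl, ← h.outer_snd]; exact o.monotone hk))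
      obtain rfl : k = p.1.2 := le_antisymm
        (h.le_of_outer _ _ (by rw [hkl, h.outer_snd])) hk
      exact I_last.symm
  have key (l) : ∃ S : Subobject (b.obj t), (∀ k, o k = l → S = O k) ∧ ∀ k, ι k = l → S = I k := by
    obtain ⟨k, rfl⟩ | ⟨k, rfl⟩ := h.cover l
    · refine ⟨O k, fun k' hk' ↦ ?_, fun k' hk' ↦ overlap hk'.symm⟩
      rw [le_antisymm (h.le_of_outer _ _ hk'.le) (h.le_of_outer _ _ hk'.ge)]
    · refine ⟨I k, fun k' hk' ↦ (overlap hk').symm, fun k' hk' ↦ ?_⟩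
      rw [le_antisymm (h.le_of_inner _ _ hk'.le) (h.le_of_inner _ _ hk'.ge)]
  choose s hsO hsI using key
  -- An outer and an inner step are compared through an end point of the diagonal.
  have s_mono : Monotone s := by
    intro l l' hl
    obtain ⟨k, rfl⟩ | ⟨k, rfl⟩ := h.cover l <;> obtain ⟨k', rfl⟩ | ⟨k', rfl⟩ := h.cover l'
    · rw [hsO _ k rfl, hsO _ k' rfl]
      exact O_mono (h.le_of_outer _ _ hl)
    · rw [hsO _ k rfl, hsI _ k' rfl]
      obtain hk | hk := h.le_or_le k
      · exact (O_mono hk).trans (I_zero.symm.le.trans (I_mono (Fin.zero_le _)))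
      · refine (O_mono (h.le_of_outer _ _ ?_)).trans (I_last.symm.le.trans
          (I_mono (h.le_of_inner _ _ ?_)))
        · rw [h.outer_snd]
          exact hl.trans (ι.monotone (Fin.le_last _))
        · rw [← h.outer_snd]
          exact (o.monotone hk).trans hl
    · rw [hsI _ k rfl, hsO _ k' rfl]
      obtain hk | hk := h.le_or_le k'
      · refine (I_mono (h.le_of_inner _ _ ?_)).trans (I_zero.le.trans
          (O_mono (h.le_of_outer _ _ ?_)))
        · rw [← h.outer_fst]
          exact hl.trans (o.monotone hk)
        · rw [h.outer_fst]
          exact (ι.monotone (Fin.zero_le _)).trans hl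
      · exact (I_mono (Fin.le_last _)).trans (I_last.le.trans (O_mono hk))
    · rw [hsI _ k rfl, hsI _ k' rfl]
      exact I_mono (h.le_of_inner _ _ hl)
  obtain ⟨A, hA, w, hw⟩ := IsFlagDiagram.exists_of_subobjects hZ ⟨s, s_mono⟩
    (by
      change IsZero (s 0 : C)
      rw [hsO 0 0 h.map_zero]
      exact (hb.isZero_obj (p := x 0) hZ rfl).of_iso (Subobject.underlyingIso (β 0)))
    (by
      change s (Fin.last n) = ⊤
      rw [hsO _ _ h.map_last]
      have : IsIso (β (Fin.last N)) := isIso_map_of_le _ _ le_rfl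
      exact Subobject.mk_eq_top_of_isIso _)
    ((mapFunctor o).obj t) h.map_zero h.map_last
  have factor {z : FlagShape n} (hz : z.1.1 = 0) {X : C} (m : X ⟶ b.obj t) (hm : Mono m)
      (hs : s z.1.2 = Subobject.mk m) : ∃ f : A.obj z ≅ X,
        f.hom ≫ m = A.map (homOfLE (le_top (t := (mapFunctor o).obj t) hz h.map_last)) ≫ w.hom := by
    obtain ⟨f, hf⟩ := hw z hz
    refine ⟨f ≪≫ Subobject.isoOfEqMk _ m hs, ?_⟩
    rw [← hf, Iso.trans_hom, Category.assoc]
    exact congrArg (f.hom ≫ ·) (Subobject.ofLEMk_comp _)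
  obtain ⟨τ, hτ⟩ := (hA.reindex o).exists_iso hb hZ t rfl rfl w fun z hz ↦ by
    obtain ⟨⟨i, k⟩, hik⟩ := z
    obtain rfl : i = 0 := hz
    exact factor (z := (mapFunctor o).obj (x k)) h.map_zero (β k) (hβ k) (hsO _ _ rfl)
  have := isIso_map_of_le A (homOfLE h.obj_eq.le) h.obj_eq.ge
  -- Compatibility on the common edge forces this choice of corner isomorphism.
  let γ : A.obj ((mapFunctor ι).obj q) ≅ a.obj q :=
    (asIso (A.map (homOfLE h.obj_eq.le))).symm ≪≫ τ.app p ≪≫ c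
  have hγ : A.map (homOfLE h.obj_eq.le) ≫ γ.hom = τ.hom.app p ≫ c.hom :=
    IsIso.hom_inv_id_assoc _ _
  obtain ⟨σ, hσ⟩ := (hA.reindex ι).exists_iso ha hZ q h.fst_eq h.snd_eq γ fun z hz ↦ by
    obtain ⟨⟨i, k⟩, hik⟩ := z
    obtain rfl : i = 0 := hz
    let z : FlagShape n := pos 0 (ι k) (Fin.zero_le _)
    obtain ⟨j, hj⟩ := factor (z := z) rfl (r k ≫ β p.1.2) inferInstance (hsI _ _ rfl)
    have hzy : z ≤ (mapFunctor ι).obj (y k) := ⟨Fin.zero_le _, le_rfl⟩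
    have hzx : z ≤ (mapFunctor o).obj (x p.1.2) := ⟨Fin.zero_le _, by
      change ι k ≤ o p.1.2
      rw [h.outer_snd]
      exact ι.monotone (Fin.le_last _)⟩
    have e : A.map (homOfLE hzx) ≫ τ.hom.app (x p.1.2) = j.hom ≫ r k := by
      rw [← cancel_mono (β p.1.2), Category.assoc, Category.assoc, hj, ← hτ,
        ← τ.hom.naturality, Functor.comp_map, ← Category.assoc, ← A.map_comp]
      rfl
    have he := hA.epi_map (homOfLE hzy) rfl
    have hm := (hA.reindex ι).mono_map (homOfLE (hyq k)) h.fst_eq.symm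
    -- The map from `A.obj z` to `a.obj q` has two epi-mono factorisations, through the inner entry
    -- of `A` and through `a.obj (y k)`.
    refine exists_iso_of_factorisations (e := A.map (homOfLE hzy)) (e' := j.hom ≫ g k) he
      (epi_comp _ _) (mono_comp _ γ.hom) (hα k) ?_
    have e1 : A.map (homOfLE hzy) ≫ A.map ((mapFunctor ι).map (homOfLE (hyq k))) =
        A.map (homOfLE hzx) ≫ A.map ((mapFunctor o).map (homOfLE hxp)) ≫
          A.map (homOfLE h.obj_eq.le) := by
      rw [← A.map_comp, ← A.map_comp, ← A.map_comp]
      rfl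
    have e2 := τ.hom.naturality (homOfLE hxp)
    rw [Functor.comp_map] at e2
    rw [Functor.comp_map, Category.assoc, ← (sqP k).w, ← Category.assoc j.hom, ← e, ← Category.assoc, e1,
      Category.assoc, Category.assoc, hγ, ← Category.assoc (A.map _) (τ.hom.app p), e2,
      Category.assoc, Category.assoc]
  exact ⟨A, hA, σ, τ, hσ ▸ hγ⟩

end IsDiagonalCut

/-! ### A criterion for 2-pullback squares of groupoids of flags -/

lemma mapFunctor_toOrderHom_obj {m n : ℕ} {α β : SimplexCategory.mk m ⟶ SimplexCategory.mk n}
    (h : α = β) (p : FlagShape m) :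
    (mapFunctor α.toOrderHom).obj p = (mapFunctor β.toOrderHom).obj p := by rw [h]

/-- Makes the identity isomorphism in the comparison functor computable: its components are order
arrows between equal positions. -/
lemma flagGroupoids_eqToHom_app {m n : ℕ} {α β : SimplexCategory.mk m ⟶ SimplexCategory.mk n}
    (h : α = β) (H : (flagReindex Z α.toOrderHom).core = (flagReindex Z β.toOrderHom).core)
    (x : Core (FlagDiagram Z n)) (p : FlagShape m) :
    ((eqToIso H).hom.app x).iso.hom.hom.app p =
      x.of.obj.map (homOfLE (mapFunctor_toOrderHom_obj h p).le) := by
  subst h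
  exact (x.of.obj.map_id _).symm

/-- A criterion for a commutative square of restriction functors between groupoids of flags
to be a 2-pullback square. -/
lemma isTwoPullback_flagGroupoids {m n N M : ℕ} {α : SimplexCategory.mk M ⟶ SimplexCategory.mk n}
    {β : SimplexCategory.mk N ⟶ SimplexCategory.mk n}
    {γ : SimplexCategory.mk m ⟶ SimplexCategory.mk M}
    {δ : SimplexCategory.mk m ⟶ SimplexCategory.mk N} (h : γ ≫ α = δ ≫ β)
    (ext : ∀ {A B : FlagShape n ⥤ C}, IsFlagDiagram Z A → IsFlagDiagram Z B → ∀ ρ ρ' : A ⟶ B,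
      Functor.whiskerLeft (mapFunctor α.toOrderHom) ρ =
        Functor.whiskerLeft (mapFunctor α.toOrderHom) ρ' →
      Functor.whiskerLeft (mapFunctor β.toOrderHom) ρ =
        Functor.whiskerLeft (mapFunctor β.toOrderHom) ρ' → ρ = ρ')
    (hom : ∀ {A B : FlagShape n ⥤ C}, IsFlagDiagram Z A → IsFlagDiagram Z B →
      ∀ (σ : mapFunctor α.toOrderHom ⋙ A ⟶ mapFunctor α.toOrderHom ⋙ B)
        (τ : mapFunctor β.toOrderHom ⋙ A ⟶ mapFunctor β.toOrderHom ⋙ B),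
      (∀ p : FlagShape m, σ.app ((mapFunctor γ.toOrderHom).obj p) ≫
        B.map (homOfLE (mapFunctor_toOrderHom_obj h p).le) =
        A.map (homOfLE (mapFunctor_toOrderHom_obj h p).le) ≫
          τ.app ((mapFunctor δ.toOrderHom).obj p)) →
      ∃ ρ : A ⟶ B, Functor.whiskerLeft (mapFunctor α.toOrderHom) ρ = σ ∧
        Functor.whiskerLeft (mapFunctor β.toOrderHom) ρ = τ)
    (glue : ∀ {a : FlagShape M ⥤ C} {b : FlagShape N ⥤ C}, IsFlagDiagram Z a →
      IsFlagDiagram Z b →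
      ∀ φ : mapFunctor γ.toOrderHom ⋙ a ≅ mapFunctor δ.toOrderHom ⋙ b,
      ∃ A : FlagShape n ⥤ C, IsFlagDiagram Z A ∧ ∃ (σ : mapFunctor α.toOrderHom ⋙ A ≅ a)
        (τ : mapFunctor β.toOrderHom ⋙ A ≅ b), ∀ p : FlagShape m,
        σ.hom.app ((mapFunctor γ.toOrderHom).obj p) ≫ φ.hom.app p =
          A.map (homOfLE (mapFunctor_toOrderHom_obj h p).le) ≫
            τ.hom.app ((mapFunctor δ.toOrderHom).obj p)) :
    IsTwoPullback ((flagGroupoids Z).map β.op) ((flagGroupoids Z).map α.op)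
      ((flagGroupoids Z).map δ.op) ((flagGroupoids Z).map γ.op) := by
  have comm : (flagGroupoids Z).map β.op ≫ (flagGroupoids Z).map δ.op =
      (flagGroupoids Z).map α.op ≫ (flagGroupoids Z).map γ.op := by
    rw [← Functor.map_comp, ← Functor.map_comp, ← op_comp, ← op_comp, h]
  refine ⟨comm, ?_⟩
  have H : (flagReindex Z α.toOrderHom).core ⋙ (flagReindex Z γ.toOrderHom).core =
    (flagReindex Z β.toOrderHom).core ⋙ (flagReindex Z δ.toOrderHom).core := comm.symm
  have app (x : Core (FlagDiagram Z n)) (p : FlagShape m) :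
      ((eqToIso H).hom.app x).iso.hom.hom.app p =
        x.of.obj.map (homOfLE (mapFunctor_toOrderHom_obj h p).le) :=
    flagGroupoids_eqToHom_app h H x p
  refine { faithful := ⟨?_⟩, full := ⟨?_⟩, essSurj := ⟨?_⟩ }
  · intro x y f g hfg
    refine Core.hom_ext (ObjectProperty.hom_ext _ (ext x.of.property y.of.property _ _ ?_ ?_))
    · exact congrArg (fun k ↦ k.iso.hom.hom) (congrArg CategoricalPullback.Hom.fst hfg)
    · exact congrArg (fun k ↦ k.iso.hom.hom) (congrArg CategoricalPullback.Hom.snd hfg)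
  · intro x y f
    have key {x y : Core (FlagDiagram Z n)} (f : (toTwoPullback (eqToIso comm.symm)).obj x ⟶
        (toTwoPullback (eqToIso comm.symm)).obj y) := hom x.of.property y.of.property
        f.fst.iso.hom.hom f.snd.iso.hom.hom fun p ↦
      (congrArg (_ ≫ ·) (app y p).symm).trans
        ((congrArg (fun k ↦ k.iso.hom.hom.app p) f.w).trans (congrArg (· ≫ _) (app x p)))
    -- `hom` only yields a morphism; it is applied to `inv f` as well, and `ext` shows the two
    -- results to be mutually inverse.
    have : IsIso f := (CategoricalPullback.isIso_iff _ _ f).2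
      ⟨IsGroupoid.all_isIso f.fst, IsGroupoid.all_isIso f.snd⟩
    obtain ⟨ρ, hρα, hρβ⟩ := key f
    obtain ⟨ρ', hρα', hρβ'⟩ := key (inv f)
    have h1 : ρ ≫ ρ' = 𝟙 _ := by
      refine ext x.of.property x.of.property _ _ ?_ ?_
      · rw [Functor.whiskerLeft_comp, hρα, hρα']
        exact congrArg (fun k ↦ k.fst.iso.hom.hom) (IsIso.hom_inv_id f)
      · rw [Functor.whiskerLeft_comp, hρβ, hρβ']
        exact congrArg (fun k ↦ k.snd.iso.hom.hom) (IsIso.hom_inv_id f)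
    have h2 : ρ' ≫ ρ = 𝟙 _ := by
      refine ext y.of.property y.of.property _ _ ?_ ?_
      · rw [Functor.whiskerLeft_comp, hρα, hρα']
        exact congrArg (fun k ↦ k.fst.iso.hom.hom) (IsIso.inv_hom_id f)
      · rw [Functor.whiskerLeft_comp, hρβ, hρβ']
        exact congrArg (fun k ↦ k.snd.iso.hom.hom) (IsIso.inv_hom_id f)
    refine ⟨(Core.isoMk (ObjectProperty.isoMk _ ⟨ρ, ρ', h1, h2⟩)).hom, ?_⟩
    refine CategoricalPullback.hom_ext (Core.hom_ext (ObjectProperty.hom_ext _ hρα))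
      (Core.hom_ext (ObjectProperty.hom_ext _ hρβ))
  · intro y
    obtain ⟨A, hA, σ, τ, hστ⟩ := glue y.fst.of.property y.snd.of.property
      ((ObjectProperty.ι _).mapIso y.iso.hom.iso)
    refine ⟨⟨A, hA⟩, ⟨CategoricalPullback.mkIso (Core.isoMk (ObjectProperty.isoMk _ σ))
      (Core.isoMk (ObjectProperty.isoMk _ τ)) ?_⟩⟩
    refine Core.hom_ext (ObjectProperty.hom_ext _ (NatTrans.ext (funext fun p ↦ ?_)))
    exact (hστ p).trans (congrArg (· ≫ _) (app ⟨⟨A, hA⟩⟩ p).symm)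

/-! ### The polygon squares -/

lemma comp_eq_comp_of_inverse {X X' Y Y' : C} {f : X ⟶ X'} {f' : X' ⟶ X} {g : Y ⟶ Y'} {g' : Y' ⟶ Y}
    {σ : X ⟶ Y} {τ : X' ⟶ Y'} (w : f' ≫ σ = τ ≫ g') (hf : f ≫ f' = 𝟙 X) (hg : g' ≫ g = 𝟙 Y') :
    σ ≫ g = f ≫ τ := by
  rw [← Category.comp_id τ, ← hg, ← Category.assoc τ, ← w, Category.assoc, ← Category.assoc f,
    hf, Category.id_comp]

lemma isDiagonalCut_polygon {n i j : ℕ} (hij : i < j) (hj : j ≤ n) :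
    IsDiagonalCut (outerPolygon i j hij hj).toOrderHom (innerPolygon i j hij hj).toOrderHom
      ((mapFunctor (outerEdge (n := n) i j).toOrderHom).obj (pos 0 1 (Fin.zero_le _)))
      ((mapFunctor (innerEdge i j).toOrderHom).obj (pos 0 1 (Fin.zero_le _))) where
  map_zero := rfl
  map_last := by
    apply Fin.ext
    change (if i + 1 + (n - j) ≤ i then _ else j + (i + 1 + (n - j) - (i + 1))) = n
    split_ifs <;> omega
  fst_eq := rfl
  snd_eq := rfl
  obj_eq := by
    apply Subtype.ext
    apply Prod.ext <;> apply Fin.ext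
    · change (if i ≤ i then i else _) = i + 0
      simp
    · change (if i + 1 ≤ i then i + 1 else j + (i + 1 - (i + 1))) = i + (j - i)
      split_ifs <;> omega
  le_or_le k := by
    -- In the outer polygon the diagonal joins the consecutive indices `i` and `i + 1`.
    change k.1 ≤ i ∨ i + 1 ≤ k.1
    omega
  cover l := by
    have hl : l.1 < n + 1 := l.2
    by_cases h : i ≤ l.1 ∧ l.1 ≤ j
    · refine .inr ⟨⟨l.1 - i, show l.1 - i < j - i + 1 by omega⟩, Fin.ext ?_⟩
      change i + (l.1 - i) = l.1
      omega
    · refine .inl ?_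
      by_cases h' : l.1 ≤ i
      · refine ⟨⟨l.1, show l.1 < i + 1 + (n - j) + 1 by omega⟩, Fin.ext ?_⟩
        change (if l.1 ≤ i then l.1 else _) = l.1
        simp [h']
      · refine ⟨⟨i + 1 + (l.1 - j), show _ < i + 1 + (n - j) + 1 by omega⟩, Fin.ext ?_⟩
        change (if i + 1 + (l.1 - j) ≤ i then _ else j + (i + 1 + (l.1 - j) - (i + 1))) = l.1
        split_ifs <;> omega
  le_of_outer k l h := by
    change (if k.1 ≤ i then k.1 else j + (k.1 - (i + 1))) ≤
      (if l.1 ≤ i then l.1 else j + (l.1 - (i + 1))) at h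
    change k.1 ≤ l.1
    split_ifs at h <;> omega
  le_of_inner k l h := by
    change i + k.1 ≤ i + l.1 at h
    change k.1 ≤ l.1
    omega

lemma innerEdge_comp_innerPolygon {n i j : ℕ} (hij : i < j) (hj : j ≤ n) :
    innerEdge i j ≫ innerPolygon i j hij hj = outerEdge i j ≫ outerPolygon i j hij hj := by
  have h := (isDiagonalCut_polygon hij hj).obj_eq
  ext k : 3
  fin_cases k
  · exact congrArg (fun p ↦ p.1.1) h.symm
  · exact congrArg (fun p ↦ p.1.2) h.symm

lemma FlagShape.eq_top_or_diag (p : FlagShape 1) :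
    p = pos 0 1 (Fin.zero_le _) ∨ p.1.1 = p.1.2 := by
  obtain ⟨⟨i, j⟩, h⟩ := p
  fin_cases i <;> fin_cases j <;> first | exact .inr rfl | exact .inl rfl | exact absurd h (by decide)

lemma isTwoPullback_polygon [ProtoAbelian C] (hZ : IsZero Z) {n i j : ℕ} (hij : i < j)
    (hj : j ≤ n) :
    IsTwoPullback ((flagGroupoids Z).map (outerPolygon i j hij hj).op)
      ((flagGroupoids Z).map (innerPolygon i j hij hj).op)
      ((flagGroupoids Z).map (outerEdge (n := n) i j).op)
      ((flagGroupoids Z).map (innerEdge i j).op) := by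
  have cut := isDiagonalCut_polygon hij hj
  refine isTwoPullback_flagGroupoids (innerEdge_comp_innerPolygon hij hj) ?_ ?_ ?_
  · intro A B hA hB ρ ρ' _ h
    -- The outer polygon contains `0` and `n`, hence sees the corner.
    exact hA.hom_ext hB _ cut.map_zero cut.map_last
      (NatTrans.congr_app h (pos 0 (Fin.last _) (Fin.zero_le _)))
  · intro A B hA hB σ τ w
    refine cut.exists_hom hZ hA hB σ τ ?_
    -- The criterion compares the edge from inner to outer, `IsDiagonalCut` from outer to inner.
    exact (comp_eq_comp_of_inverse (w _).symm
      ((A.map_comp _ _).symm.trans (A.map_id _)) ((B.map_comp _ _).symm.trans (B.map_id _))).symm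
  · intro a b ha hb φ
    obtain ⟨A, hA, σ, τ, w⟩ := cut.exists_glue hZ ha hb (φ.app (pos 0 1 (Fin.zero_le _))).symm
    refine ⟨A, hA, σ, τ, fun p ↦ ?_⟩
    -- Only the entry at `(0, 1)` carries a condition; the diagonal ones are zero.
    obtain rfl | hp := p.eq_top_or_diag
    · exact comp_eq_comp_of_inverse w ((A.map_comp _ _).symm.trans (A.map_id _))
        (φ.app _).inv_hom_id
    · exact ((hb.reindex _).isZero_obj hZ hp).eq_of_tgt _ _

/-! ### The degeneracy squares -/

lemma IsFlagDiagram.isIso_map_right {n : ℕ} {A : FlagShape n ⥤ C} (hA : IsFlagDiagram Z A)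
    {p q r s : FlagShape n} (pq : p ⟶ q) (pr : p ⟶ r)
    (qs : q ⟶ s) (rs : r ⟶ s) (hpq : p.1.1 = q.1.1) (hrs : r.1.1 = s.1.1) (hpr : p.1.2 = r.1.2)
    (hqs : q.1.2 = s.1.2) (zr : IsZero (A.obj r)) (zs : IsZero (A.obj s)) : IsIso (A.map pq) := by
  have : IsIso (A.map rs) := by
    rw [zr.eq_of_src (A.map rs) (zr.iso zs).hom]
    infer_instance
  exact (hA.bicartesianSq_map pq pr qs rs hpq hrs hpr hqs).toIsPullback.isIso_fst_of_isIso

lemma IsFlagDiagram.isIso_map_down {n : ℕ} {A : FlagShape n ⥤ C} (hA : IsFlagDiagram Z A)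
    {p q r s : FlagShape n} (pq : p ⟶ q) (pr : p ⟶ r)
    (qs : q ⟶ s) (rs : r ⟶ s) (hpq : p.1.1 = q.1.1) (hrs : r.1.1 = s.1.1) (hpr : p.1.2 = r.1.2)
    (hqs : q.1.2 = s.1.2) (zp : IsZero (A.obj p)) (zr : IsZero (A.obj r)) : IsIso (A.map qs) := by
  have : IsIso (A.map pr) := by
    rw [zp.eq_of_src (A.map pr) (zp.iso zr).hom]
    infer_instance
  exact (hA.bicartesianSq_map pq pr qs rs hpq hrs hpr hqs).toIsPushout.isIso_inl_of_isIso

/-- Doubling after omission is the idempotent that sends `i + 1` to `i` and fixes all other indices.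
-/
lemma succAbove_predAbove_eq_or {n : ℕ} (i : Fin (n + 1)) (k : Fin (n + 2)) :
    i.succ.succAbove (i.predAbove k) = k ∨
      (k = i.succ ∧ i.succ.succAbove (i.predAbove k) = i.castSucc) := by
  simp only [Fin.ext_iff, Fin.succAbove, Fin.predAbove, Fin.lt_def]
  split_ifs <;>
    simp only [Fin.val_castSucc, Fin.val_succ, Fin.val_pred, Fin.coe_castPred, true_or] at * <;>
    have hi : i.castSucc.1 = i.1 := rfl <;> omega

lemma mapFunctor_succAbove_predAbove_le {n : ℕ} (i : Fin (n + 1)) (p : FlagShape (n + 1)) :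
    (mapFunctor (SimplexCategory.δ i.succ).toOrderHom).obj
      ((mapFunctor (SimplexCategory.σ i).toOrderHom).obj p) ≤ p := by
  have key (k : Fin (n + 2)) : i.succ.succAbove (i.predAbove k) ≤ k := by
    obtain h | ⟨rfl, h⟩ := succAbove_predAbove_eq_or i k
    · exact h.le
    · rw [h]
      exact Fin.castSucc_lt_succ.le
  exact ⟨key _, key _⟩

lemma mapFunctor_predAbove_succAbove {n : ℕ} (i : Fin (n + 1)) (p : FlagShape n) :
    (mapFunctor (SimplexCategory.σ i).toOrderHom).obj
      ((mapFunctor (SimplexCategory.δ i.succ).toOrderHom).obj p) = p :=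
  mapFunctor_toOrderHom_obj (SimplexCategory.δ_comp_σ_succ (i := i)) p

/-- Omitting a doubled row and column and doubling the preceding ones does not change a flag
diagram, up to isomorphism. -/
lemma IsFlagDiagram.isIso_map_succAbove_predAbove {n : ℕ} {A : FlagShape (n + 1) ⥤ C}
    (hA : IsFlagDiagram Z A) (hZ : IsZero Z) (i : Fin (n + 1))
    (h0 : IsZero (A.obj (pos i.castSucc i.succ Fin.castSucc_lt_succ.le)))
    (p : FlagShape (n + 1)) :
    IsIso (A.map (homOfLE (mapFunctor_succAbove_predAbove_le i p))) := by
  have hle := mapFunctor_succAbove_predAbove_le i p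
  obtain ⟨⟨k, l⟩, hkl⟩ := p
  set k' := i.succ.succAbove (i.predAbove k) with hk'
  set l' := i.succ.succAbove (i.predAbove l) with hl'
  have hkl' : k' ≤ l' := ((mapFunctor (SimplexCategory.δ i.succ).toOrderHom).obj
    ((mapFunctor (SimplexCategory.σ i).toOrderHom).obj ⟨(k, l), hkl⟩)).2
  have hk : k' ≤ k := hle.1
  have hl : l' ≤ l := hle.2
  have h1 : pos k' l' hkl' ≤ pos k' l (hk.trans hkl) := ⟨le_rfl, hl⟩
  have h2 : pos k' l (hk.trans hkl) ≤ pos k l hkl := ⟨hk, le_rfl⟩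
  have i1 : IsIso (A.map (homOfLE h1)) := by
    obtain h | ⟨hs, hc⟩ := succAbove_predAbove_eq_or i l
    · exact isIso_map_of_le _ _ ⟨le_rfl, h.ge⟩
    · have hki : k' ≤ i.castSucc := hkl'.trans hc.le
      -- The square with rows `k'` and `i` has lower side `A_{i,i} ⟶ A_{i,i+1}`, a map of zero
      -- objects.
      exact hA.isIso_map_right (r := pos i.castSucc i.castSucc le_rfl)
        (s := pos i.castSucc i.succ Fin.castSucc_lt_succ.le) _ (homOfLE ⟨hki, hc.le⟩)
        (homOfLE ⟨hki, hs.le⟩) (homOfLE ⟨le_rfl, Fin.castSucc_lt_succ.le⟩) rfl rfl hc hs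
        (hA.isZero_obj hZ rfl) h0
  have i2 : IsIso (A.map (homOfLE h2)) := by
    obtain h | ⟨hs, hc⟩ := succAbove_predAbove_eq_or i k
    · exact isIso_map_of_le _ _ ⟨h.ge, le_rfl⟩
    · have hil : i.succ ≤ l := hs.ge.trans hkl
      -- The square with columns `i + 1` and `l` has left side `A_{i,i+1} ⟶ A_{i+1,i+1}`, a map of
      -- zero objects.
      exact hA.isIso_map_down (p := pos i.castSucc i.succ Fin.castSucc_lt_succ.le)
        (r := pos i.succ i.succ le_rfl) (homOfLE ⟨hc.ge, hil⟩)
        (homOfLE ⟨Fin.castSucc_lt_succ.le, le_rfl⟩) _ (homOfLE ⟨hs.ge, hil⟩) hc.symm hs.symm rfl rfl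
        h0 (hA.isZero_obj hZ rfl)
  have e : A.map (homOfLE hle) = A.map (homOfLE h1) ≫ A.map (homOfLE h2) := A.map_comp _ _
  rw [e]
  exact IsIso.comp_isIso' i1 i2

lemma mkOfSucc_comp_σ {n : ℕ} (i : Fin (n + 1)) :
    SimplexCategory.mkOfSucc i ≫ SimplexCategory.σ i =
      SimplexCategory.σ (0 : Fin 1) ≫ SimplexCategory.const (.mk 0) (.mk n) i := by
  ext k : 3
  fin_cases k
  · exact Fin.predAbove_castSucc_self i
  · exact Fin.predAbove_succ_self i

/-- Size `0` diagrams carry no information, so everything is decided by the degeneracy `d` and its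
section `s`, which omits row and column `i + 1`. -/
lemma isTwoPullback_degeneracy (hZ : IsZero Z) {n : ℕ} (i : Fin (n + 1)) :
    IsTwoPullback ((flagGroupoids Z).map (SimplexCategory.const (.mk 0) (.mk n) i).op)
      ((flagGroupoids Z).map (SimplexCategory.σ i).op)
      ((flagGroupoids Z).map (SimplexCategory.σ (0 : Fin 1)).op)
      ((flagGroupoids Z).map (SimplexCategory.mkOfSucc i).op) := by
  let s := mapFunctor (SimplexCategory.δ i.succ).toOrderHom
  let d := mapFunctor (SimplexCategory.σ i).toOrderHom
  have hds (p : FlagShape n) : d.obj (s.obj p) = p := mapFunctor_predAbove_succAbove i p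
  have hsd (p : FlagShape (n + 1)) : s.obj (d.obj p) ≤ p := mapFunctor_succAbove_predAbove_le i p
  have zero {b : FlagShape 0 ⥤ C} (hb : IsFlagDiagram Z b) (p : FlagShape 0) : IsZero (b.obj p) :=
    hb.isZero_obj hZ (Subsingleton.elim (α := Fin 1) _ _)
  refine isTwoPullback_flagGroupoids (mkOfSucc_comp_σ i) ?_ ?_ ?_
  · intro A B hA hB ρ ρ' h _
    ext p
    rw [← hds p]
    exact NatTrans.congr_app h (s.obj p)
  · intro A B hA hB σ τ _
    let ρ : A ⟶ B :=
      { app p := A.map (homOfLE (hds p).ge) ≫ σ.app (s.obj p) ≫ B.map (homOfLE (hds p).le)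
        naturality p q a := by
          have e := σ.naturality (s.map a)
          simp only [Functor.comp_map] at e
          rw [Category.assoc, Category.assoc, ← B.map_comp, ← A.map_comp_assoc]
          have e1 : a ≫ homOfLE (hds q).ge = homOfLE (hds p).ge ≫ d.map (s.map a) := rfl
          have e2 : homOfLE (hds p).le ≫ a = d.map (s.map a) ≫ homOfLE (hds q).le := rfl
          rw [e1, e2, A.map_comp, B.map_comp, Category.assoc, ← Category.assoc (σ.app _), ← e,
            Category.assoc] }
    refine ⟨ρ, ?_, ?_⟩
    · ext p
      have e := σ.naturality (homOfLE (hsd p))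
      simp only [Functor.comp_map] at e
      -- Naturality of `σ` along `s (d p) ≤ p` suffices, since `d` sends this arrow to an identity.
      change A.map _ ≫ σ.app (s.obj (d.obj p)) ≫ B.map (d.map (homOfLE (hsd p))) = _
      rw [← e, ← A.map_comp_assoc]
      exact (congrArg (· ≫ _) (A.map_id _)).trans (Category.id_comp _)
    · ext p
      exact (zero (hB.reindex _) p).eq_of_tgt _ _
  · intro a b ha hb φ
    -- `φ` identifies the edge `{i, i + 1}` of `a` with a degenerate, hence zero, one.
    have h0 : IsZero (a.obj (pos i.castSucc i.succ Fin.castSucc_lt_succ.le)) :=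
      (zero hb _).of_iso (φ.app (pos 0 1 (Fin.zero_le _)))
    have hA : IsFlagDiagram Z (s ⋙ a) := ha.reindex _
    let ε : d ⋙ s ⋙ a ⟶ a :=
      { app p := a.map (homOfLE (hsd p))
        naturality p q f := by
          change a.map _ ≫ a.map _ = _
          rw [← a.map_comp, ← a.map_comp]
          rfl }
    have hε (p) : IsIso (ε.app p) := ha.isIso_map_succAbove_predAbove hZ i h0 p
    have : IsIso ε := NatIso.isIso_of_isIso_app ε
    exact ⟨s ⋙ a, hA, asIso ε,
      NatIso.ofComponents (fun p ↦ (zero (hA.reindex _) p).iso (zero hb p))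
        (fun _ ↦ (zero hb _).eq_of_tgt _ _),
      fun p ↦ (zero hb _).eq_of_tgt _ _⟩

end

theorem mainTheorem1 {C : Type u} [Category.{v} C] [ProtoAbelian C] (Z : C) (hZ : IsZero Z) :
    IsTwoSegal (flagGroupoids Z) where
  polygon _ _ _ hij hj _ := isTwoPullback_polygon hZ (Nat.lt_of_succ_lt hij) hj
  degeneracy _ i := isTwoPullback_degeneracy hZ i
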